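/- A randomized one-pass streaming algorithm with $s$ bits of memory over a finite universe $U$ has memory states in $\{0,1\}^s$; its initial state is random, its state after the $i$-th stream element is drawn from a distribution depending only on $i$, the previous state and the $i$-th element, and its real-valued answer is drawn from a distribution depending only on the final state. For a stream $x=(x_1,\dots,x_n)\in U^n$ let $F_2(x)=\sum_{u\in U}|\{i: x_i=u\}|^2$. The algorithm is a $(1\pm\varepsilon)$-approximation of $F_2$ on streams of length $n$ if for every $x\in U^n$ its answer lies in $[(1-\varepsilon)F_2(x),(1+\varepsilon)F_2(x)]$ with probability at least $2/3$. For every $\varepsilon=\Omega(1/\sqrt n)$ that is bounded away from $1$ from above, every such approximation needs $\Omega(1/\varepsilon^2)$ bits of memory. Precisely: for every $c>0$ there is a constant $C>0$, depending only on $c$, such that for every $\delta>0$ and all sufficiently large $n$ (depending on $c$ and $\delta$) the following holds. If $c/\sqrt n\le\varepsilon\le 1-\delta$, $|U|\ge n$, and a streaming algorithm over $U$ with $s$ bits of memory is a $(1\pm\varepsilon)$-approximation of $F_2$ on streams of length $n$, then $s\ge C/\varepsilon^2$. -/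

import Mathlib

open scoped ENNReal

/-- The second frequency moment of a stream over the universe `U`: the sum over all elements of
the universe of the square of the number of occurrences in the stream. -/
def secondMoment {U : Type*} [Fintype U] [DecidableEq U] (l : List U) : ℕ :=
  ∑ x : U, l.count x ^ 2

/-- A randomized one-pass streaming algorithm over the universe `U` with `s` bits of memory.
A memory state is a string of `s` bits. The initial state is random, the state after the
`i`-th stream element is drawn from a distribution that depends only on (the time step and) the
previous state and that element, and the answer is drawn from a distribution that depends only on
the final state. There is no uniformity or running time restriction, and neither the clock nor
fresh random bits are charged to the memory. -/
structure StreamingAlgorithm (U : Type*) (s : ℕ) where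
  init : PMF (Fin s → Bool)
  step : ℕ → (Fin s → Bool) → U → PMF (Fin s → Bool)
  output : (Fin s → Bool) → PMF ℝ

namespace StreamingAlgorithm

variable {U : Type*} {s : ℕ}

/-- The distribution of the memory state after reading the given list of elements, when the
algorithm is at time step `i` in memory state `m`. -/
noncomputable def memoryFrom (A : StreamingAlgorithm U s) :
    ℕ → (Fin s → Bool) → List U → PMF (Fin s → Bool)
  | _, m, [] => PMF.pure m
  | i, m, x :: l => (A.step i m x).bind fun m' => A.memoryFrom (i + 1) m' l

/-- The distribution of the memory state after reading the whole stream `l`. -/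
noncomputable def finalMemory (A : StreamingAlgorithm U s) (l : List U) : PMF (Fin s → Bool) :=
  A.init.bind fun m => A.memoryFrom 0 m l

/-- The distribution of the answer of the algorithm on the stream `l`. -/
noncomputable def answer (A : StreamingAlgorithm U s) (l : List U) : PMF ℝ :=
  (A.finalMemory l).bind A.output

/-- On every stream of length `n`, the answer of the algorithm is, with probability at least `2/3`
over its own randomness, within a multiplicative error `1 ± ε` of the second frequency moment. -/
def ApproximatesSecondMoment [Fintype U] [DecidableEq U] (A : StreamingAlgorithm U s)
    (n : ℕ) (ε : ℝ) : Prop :=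
  ∀ l : List U, l.length = n →
    (2 / 3 : ℝ≥0∞) ≤ (A.answer l).toOuterMeasure
      {a : ℝ | (1 - ε) * (secondMoment l : ℝ) ≤ a ∧ a ≤ (1 + ε) * (secondMoment l : ℝ)}

end StreamingAlgorithm

/-!
An accurate algorithm solves the one-way gap inner product problem. Two sign vectors
`x, y ∈ {±1}^N` are turned into two halves of a stream: coordinate `i` of `x` contributes `t`
copies of the element `(i, x i)`, and likewise for `y`; a few fresh elements, each occurring once,
bring the length to `n`. The second moment is then `t ^ 2 * (3 * N + ⟪x, y⟫) + r`
(`secondMoment_bitStream_append`), so with `N` of order `1 / ε ^ 2` a `(1 ± ε)`-approximation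
reveals the sign of `⟪x, y⟫` whenever `|⟪x, y⟫| ≥ √N / 32`. The memory state between the two halves
is a one-way message of `s` bits.

Such a message needs a number of bits linear in `N` (`gap_inner_one_way`). Let `f x z` be the
probability of the state `z` after `x`, and `g z y` the probability that the second half, started
in the state `z`, leads to the answer "positive". On average over uniform `x, y`, the quantity
`⟪x, y⟫ * ∑ z, f x z * (2 * g z y - 1)` is at least of order `√N`, because `|⟪x, y⟫|` is of order
`√N` on average (`sum_abs_inner_sign_ge`). On the other hand, averaging over `y` first turns it into
`∑ z, f x z * ⟪x, w z⟫`, where `w z` is the vector of degree-one Fourier coefficients of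
`2 * g z · - 1` and has Euclidean norm at most `1` by Bessel's inequality (`sum_sq_sign_coeff_le`).
This is at most the maximum of `2 ^ s` subgaussian variables, whose mean is `O(√s)`
(`correlation_le_log_card`). Hence `s` is at least of order `N`.

When `ε` is so large that no such `N ≥ 1` exists, only `s ≥ 1` has to be shown: an algorithm
without memory cannot tell a constant stream from one with distinct elements
(`StreamingAlgorithm.pos_of_approximates`).
-/

/-! ### Random signs -/

/-- The sign encoded by a bit: `1` for `true` and `-1` for `false`. -/
def boolSign (b : Bool) : ℝ := if b then 1 else -1

@[simp] lemma boolSign_mul_self (b : Bool) : boolSign b * boolSign b = 1 := by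
  cases b <;> norm_num [boolSign]

@[simp] lemma boolSign_not (b : Bool) : boolSign (!b) = -boolSign b := by
  cases b <;> norm_num [boolSign]

/-- A sum of weights `w` with uniform signs is subgaussian with variance proxy `∑ i, w i ^ 2`. -/
lemma sum_exp_sign_le {N : ℕ} (w : Fin N → ℝ) :
    ∑ y : Fin N → Bool, Real.exp (∑ i, w i * boolSign (y i)) ≤
      2 ^ N * Real.exp ((∑ i, w i ^ 2) / 2) := by
  have h : ∑ y : Fin N → Bool, Real.exp (∑ i, w i * boolSign (y i)) =
      ∏ i, 2 * Real.cosh (w i) := by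
    simp only [Real.exp_sum]
    rw [← Fintype.prod_sum fun i b => Real.exp (w i * boolSign b)]
    refine Finset.prod_congr rfl fun i _ => ?_
    simp [boolSign, Real.cosh_eq]
    ring
  rw [h, Finset.prod_mul_distrib, Finset.sum_div, Real.exp_sum]
  simp only [Finset.prod_const, Finset.card_univ, Fintype.card_fin]
  gcongr with i
  exact Real.cosh_le_exp_half_sq _

/-- The real part of the characteristic function of `⟪x, y⟫` for uniform `y`. The signs of `x` do not
matter, as the cosine is even. -/
lemma sum_cos_sign {N : ℕ} (x : Fin N → Bool) (t : ℝ) :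
    ∑ y : Fin N → Bool, Real.cos (t * ∑ i, boolSign (x i) * boolSign (y i)) =
      2 ^ N * Real.cos t ^ N := by
  have h : ∑ y : Fin N → Bool,
      Complex.exp (∑ i, ((t * (boolSign (x i) * boolSign (y i)) : ℝ) : ℂ) * Complex.I) =
      ((2 ^ N * Real.cos t ^ N : ℝ) : ℂ) := by
    simp only [Complex.exp_sum]
    rw [← Fintype.prod_sum fun i b =>
      Complex.exp (((t * (boolSign (x i) * boolSign b) : ℝ) : ℂ) * Complex.I)]
    have : ∀ i, ∑ b : Bool,
        Complex.exp (((t * (boolSign (x i) * boolSign b) : ℝ) : ℂ) * Complex.I) =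
        2 * Complex.cos t := by
      intro i
      rw [Complex.cos]
      cases x i <;> simp [boolSign] <;> ring
    rw [Finset.prod_congr rfl fun i _ => this i]
    simp [mul_pow]
  have h2 := congrArg Complex.re h
  rw [Complex.ofReal_re, Complex.re_sum] at h2
  rw [← h2]
  refine Finset.sum_congr rfl fun y _ => ?_
  rw [← Finset.sum_mul, ← Complex.ofReal_sum, Complex.exp_ofReal_mul_I_re, Finset.mul_sum]

lemma one_sub_cos_le_abs (v : ℝ) : 1 - Real.cos v ≤ |v| := by
  have h1 := Real.one_sub_sq_div_two_le_cos (x := v)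
  have h2 := Real.neg_one_le_cos v
  have h3 := sq_abs v
  rcases le_or_gt |v| 2 with h | h
  · nlinarith [abs_nonneg v]
  · linarith

lemma cos_inv_sqrt_pow_le {N : ℕ} (hN : 0 < N) : Real.cos (1 / √N) ^ N ≤ 3 / 4 := by
  have hN' : (1 : ℝ) ≤ N := by exact_mod_cast hN
  have hs : 0 < √(N : ℝ) := by positivity
  have hle : 1 / √(N : ℝ) ≤ 1 := by
    rw [div_le_one hs]; exact Real.one_le_sqrt.2 hN'
  have h0 : 0 ≤ 1 / √(N : ℝ) := by positivity
  have hpi := Real.pi_gt_three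
  have hc := Real.cos_le_one_div_sqrt_sq_add_one (x := 1 / √(N : ℝ)) (by linarith) (by linarith)
  have hc0 : 0 ≤ Real.cos (1 / √(N : ℝ)) :=
    Real.cos_nonneg_of_neg_pi_div_two_le_of_le (by linarith) (by linarith)
  have hsq : (1 / √(N : ℝ)) ^ 2 = 1 / N := by
    rw [div_pow, Real.sq_sqrt (by positivity), one_pow]
  have hb : (2 : ℝ) ≤ (1 / N + 1) ^ N := by
    have := one_add_mul_le_pow (a := (1 : ℝ) / N) (by have : (0 : ℝ) ≤ 1 / N := by positivity
                                                      linarith) N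
    rw [mul_one_div_cancel (by positivity)] at this
    rw [add_comm (1 / (N : ℝ))]; linarith
  have hb2 : (Real.cos (1 / √(N : ℝ)) ^ N) ^ 2 ≤ 1 / 2 := by
    calc (Real.cos (1 / √(N : ℝ)) ^ N) ^ 2 = (Real.cos (1 / √(N : ℝ)) ^ 2) ^ N := by ring
      _ ≤ ((1 / √((1 / √(N : ℝ)) ^ 2 + 1)) ^ 2) ^ N := by gcongr
      _ = 1 / (1 / N + 1) ^ N := by
        rw [div_pow, Real.sq_sqrt (by positivity), one_pow, hsq, div_pow, one_pow]
      _ ≤ 1 / 2 := by gcongr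
  nlinarith [pow_nonneg hc0 N]

/-- The mean of `|⟪x, y⟫|` over `y` is at least `√N / 4`. This follows from `1 - cos v ≤ |v|` at
`v = ⟪x, y⟫ / √N`, since the mean of the cosine is `cos (1 / √N) ^ N`, which is bounded away
from `1`. -/
lemma sum_abs_inner_sign_ge {N : ℕ} (hN : 0 < N) (x : Fin N → Bool) :
    2 ^ N * (√N / 4) ≤ ∑ y : Fin N → Bool, |∑ i, boolSign (x i) * boolSign (y i)| := by
  have hs : 0 < √(N : ℝ) := by positivity
  have h1 : ∑ y : Fin N → Bool, (1 - Real.cos (1 / √N * ∑ i, boolSign (x i) * boolSign (y i))) ≤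
      ∑ y : Fin N → Bool, 1 / √N * |∑ i, boolSign (x i) * boolSign (y i)| := by
    refine Finset.sum_le_sum fun y _ => (one_sub_cos_le_abs _).trans_eq ?_
    rw [abs_mul, abs_of_pos (by positivity)]
  rw [Finset.sum_sub_distrib, sum_cos_sign, ← Finset.mul_sum] at h1
  have h2 := mul_le_mul_of_nonneg_left (cos_inv_sqrt_pow_le hN) (by positivity : (0 : ℝ) ≤ 2 ^ N)
  have h3 : (2 : ℝ) ^ N / 4 ≤
      1 / √N * ∑ y : Fin N → Bool, |∑ i, boolSign (x i) * boolSign (y i)| := by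
    have : ∑ y : Fin N → Bool, (1 : ℝ) = 2 ^ N := by simp
    linarith
  rw [one_div_mul_eq_div, le_div_iff₀ hs] at h3
  linarith

lemma sum_sign_mul_sign {N : ℕ} (i j : Fin N) :
    ∑ y : Fin N → Bool, boolSign (y i) * boolSign (y j) = if i = j then 2 ^ N else 0 := by
  split_ifs with h
  · subst h; simp
  · refine Finset.sum_involution (fun y _ => Function.update y i (!y i)) ?_ ?_ ?_ ?_
    · intro y _
      simp [Function.update_of_ne (Ne.symm h)]
    · intro y _ _ h'
      have := congrFun h' i
      simp at this
    · intro y _; simp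
    · intro y _; simp

/-- Bessel's inequality for the degree-one Fourier coefficients of a bounded function on the cube;
the coefficients here are not divided by `2 ^ N`. -/
lemma sum_sq_sign_coeff_le {N : ℕ} (G : (Fin N → Bool) → ℝ) (hG : ∀ y, |G y| ≤ 1) :
    ∑ i, (∑ y, G y * boolSign (y i)) ^ 2 ≤ (2 ^ N) ^ 2 := by
  set w : Fin N → ℝ := fun i => ∑ y, G y * boolSign (y i) with hw
  have hM : (0 : ℝ) < 2 ^ N := by positivity
  have h0 : 0 ≤ ∑ y, (2 ^ N * G y - ∑ i, w i * boolSign (y i)) ^ 2 :=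
    Finset.sum_nonneg fun _ _ => sq_nonneg _
  have h1 : ∑ y, G y * ∑ i, w i * boolSign (y i) = ∑ i, w i ^ 2 := by
    simp_rw [Finset.mul_sum]
    rw [Finset.sum_comm]
    refine Finset.sum_congr rfl fun i _ => ?_
    rw [sq, ← mul_comm (w i)]
    conv_rhs => rhs; rw [hw]
    simp only [Finset.mul_sum]
    exact Finset.sum_congr rfl fun y _ => by ring
  have h2 : ∑ y : Fin N → Bool, (∑ i, w i * boolSign (y i)) ^ 2 = 2 ^ N * ∑ i, w i ^ 2 := by
    have : ∀ y : Fin N → Bool, (∑ i, w i * boolSign (y i)) ^ 2 =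
        ∑ i, ∑ j, w i * w j * (boolSign (y i) * boolSign (y j)) := by
      intro y
      rw [sq, Finset.sum_mul_sum]
      exact Finset.sum_congr rfl fun i _ => Finset.sum_congr rfl fun j _ => by ring
    simp_rw [this]
    rw [Finset.sum_comm, Finset.mul_sum]
    refine Finset.sum_congr rfl fun i _ => ?_
    rw [Finset.sum_comm]
    simp_rw [← Finset.mul_sum, sum_sign_mul_sign]
    simp
    ring
  have h3 : ∑ y, G y ^ 2 ≤ 2 ^ N := by
    calc ∑ y, G y ^ 2 ≤ ∑ y : Fin N → Bool, (1 : ℝ) :=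
          Finset.sum_le_sum fun y _ => (sq_le_one_iff_abs_le_one _).2 (hG y)
      _ = 2 ^ N := by simp
  have h4 : ∑ y, (2 ^ N * G y - ∑ i, w i * boolSign (y i)) ^ 2 =
      (2 ^ N) ^ 2 * ∑ y, G y ^ 2 - 2 * 2 ^ N * ∑ y, G y * ∑ i, w i * boolSign (y i)
        + ∑ y : Fin N → Bool, (∑ i, w i * boolSign (y i)) ^ 2 := by
    rw [Finset.mul_sum, Finset.mul_sum, ← Finset.sum_sub_distrib, ← Finset.sum_add_distrib]
    exact Finset.sum_congr rfl fun y _ => by ring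
  rw [h4, h1, h2] at h0
  have h5 : 2 ^ N * ∑ i, w i ^ 2 ≤ 2 ^ N * (2 ^ N) ^ 2 := by nlinarith
  exact le_of_mul_le_mul_left h5 hM

/-- If each `x` picks `z` with probability `f x z`, the mean of `⟪x, w z⟫` is at most the mean of the
maximum of the subgaussian variables `⟪x, w z⟫`, which the exponential moment method bounds by
`(log (card Z) + t ^ 2 / 2) / t`. -/
lemma correlation_le_log_card {N : ℕ} {Z : Type*} [Fintype Z] [Nonempty Z]
    (f : (Fin N → Bool) → Z → ℝ) (hf : ∀ x z, 0 ≤ f x z) (hf1 : ∀ x, ∑ z, f x z = 1)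
    (w : Z → Fin N → ℝ) (hw : ∀ z, ∑ i, w z i ^ 2 ≤ 1) (t : ℝ) :
    t * ∑ x, ∑ z, f x z * ∑ i, w z i * boolSign (x i) ≤
      2 ^ N * (Real.log (Fintype.card Z) + t ^ 2 / 2) := by
  have hZ : (0 : ℝ) < Fintype.card Z := by exact_mod_cast Fintype.card_pos
  set L := Real.log (Fintype.card Z) + t ^ 2 / 2 with hL
  have hf2 : ∀ x z, f x z ≤ 1 := fun x z => by
    rw [← hf1 x]
    exact Finset.single_le_sum (fun z _ => hf x z) (Finset.mem_univ z)
  -- `L` is the logarithm of the bound on the mean of `∑ z, exp (t * ⟪x, w z⟫)`; the tangent line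
  -- `1 + v ≤ exp v` at `v = t * ⟪x, w z⟫ - L` replaces an application of Jensen's inequality.
  have h1 : ∑ x, ∑ z, f x z * (1 + (t * ∑ i, w z i * boolSign (x i) - L)) ≤
      ∑ x : Fin N → Bool, ∑ z, Real.exp (t * ∑ i, w z i * boolSign (x i) - L) := by
    refine Finset.sum_le_sum fun x _ => Finset.sum_le_sum fun z _ => ?_
    have := Real.add_one_le_exp (t * ∑ i, w z i * boolSign (x i) - L)
    calc _ ≤ f x z * Real.exp (t * ∑ i, w z i * boolSign (x i) - L) :=
          mul_le_mul_of_nonneg_left (by linarith) (hf x z)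
      _ ≤ 1 * Real.exp (t * ∑ i, w z i * boolSign (x i) - L) :=
          mul_le_mul_of_nonneg_right (hf2 x z) (Real.exp_pos _).le
      _ = _ := one_mul _
  have h2 : ∀ z, ∑ x : Fin N → Bool, Real.exp (t * ∑ i, w z i * boolSign (x i) - L) ≤
      2 ^ N / Fintype.card Z := by
    intro z
    have := sum_exp_sign_le fun i => t * w z i
    calc ∑ x : Fin N → Bool, Real.exp (t * ∑ i, w z i * boolSign (x i) - L)
        = (∑ x : Fin N → Bool, Real.exp (∑ i, t * w z i * boolSign (x i))) * Real.exp (-L) := by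
          rw [Finset.sum_mul]
          refine Finset.sum_congr rfl fun x _ => ?_
          rw [← Real.exp_add, Finset.mul_sum]
          simp only [mul_assoc]; rfl
      _ ≤ (2 ^ N * Real.exp ((∑ i, (t * w z i) ^ 2) / 2)) * Real.exp (-L) := by gcongr
      _ ≤ (2 ^ N * Real.exp (t ^ 2 / 2)) * Real.exp (-L) := by
          gcongr
          simp_rw [mul_pow]
          rw [← Finset.mul_sum]
          exact mul_le_of_le_one_right (sq_nonneg t) (hw z)
      _ = 2 ^ N / Fintype.card Z := by
          rw [mul_assoc, ← Real.exp_add, hL,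
            show t ^ 2 / 2 + -(Real.log (Fintype.card Z) + t ^ 2 / 2) =
              -Real.log (Fintype.card Z) by ring,
            Real.exp_neg, Real.exp_log hZ]
          rfl
  have h3 : ∑ x : Fin N → Bool, ∑ z, Real.exp (t * ∑ i, w z i * boolSign (x i) - L) ≤ 2 ^ N := by
    rw [Finset.sum_comm]
    calc _ ≤ ∑ z : Z, (2 : ℝ) ^ N / Fintype.card Z := Finset.sum_le_sum fun z _ => h2 z
      _ = 2 ^ N := by
        rw [Finset.sum_const, Finset.card_univ, nsmul_eq_mul]; field_simp
  have h4 : ∑ x, ∑ z, f x z * (1 + (t * ∑ i, w z i * boolSign (x i) - L)) =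
      2 ^ N * (1 - L) + t * ∑ x, ∑ z, f x z * ∑ i, w z i * boolSign (x i) := by
    have : ∀ x, ∑ z, f x z * (1 + (t * ∑ i, w z i * boolSign (x i) - L)) =
        (1 - L) + t * ∑ z, f x z * ∑ i, w z i * boolSign (x i) := by
      intro x
      rw [Finset.mul_sum, ← one_mul (1 - L), ← hf1 x, Finset.sum_mul, ← Finset.sum_add_distrib]
      exact Finset.sum_congr rfl fun z _ => by rw [hf1 x]; ring
    simp_rw [this]
    rw [Finset.sum_add_distrib, ← Finset.mul_sum]
    simp
    ring
  nlinarith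

/-! ### One-way communication for the gap inner product problem -/

/-- A one-way protocol with message set `Z` that decides the sign of `⟪x, y⟫` with error at most
`1 / 3` whenever `|⟪x, y⟫| ≥ √N / 32` has `log (card Z)` at least linear in `N`. Here `f x z` is the
probability of sending `z` on input `x`, and `g z y` is the probability of accepting when `z` is
received on input `y`. -/
theorem gap_inner_one_way {N : ℕ} (hN : 0 < N) {Z : Type*} [Fintype Z] [Nonempty Z]
    (f : (Fin N → Bool) → Z → ℝ) (hf : ∀ x z, 0 ≤ f x z) (hf1 : ∀ x, ∑ z, f x z = 1)
    (g : Z → (Fin N → Bool) → ℝ) (hg0 : ∀ z y, 0 ≤ g z y) (hg1 : ∀ z y, g z y ≤ 1)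
    (hhigh : ∀ x y, √N / 32 ≤ ∑ i, boolSign (x i) * boolSign (y i) →
      2 / 3 ≤ ∑ z, f x z * g z y)
    (hlow : ∀ x y, ∑ i, boolSign (x i) * boolSign (y i) ≤ -(√N / 32) →
      ∑ z, f x z * g z y ≤ 1 / 3) :
    (N : ℝ) / 1152 ≤ Real.log (Fintype.card Z) := by
  have hs : 0 < √(N : ℝ) := by positivity
  have hM : (0 : ℝ) < 2 ^ N := by positivity
  set u : (Fin N → Bool) → (Fin N → Bool) → ℝ :=
    fun x y => ∑ i, boolSign (x i) * boolSign (y i) with hu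
  set G : Z → (Fin N → Bool) → ℝ := fun z y => 2 * g z y - 1 with hG
  have hGabs : ∀ z y, |G z y| ≤ 1 := fun z y => by
    rw [abs_le]; constructor <;> simp only [hG] <;> linarith [hg0 z y, hg1 z y]
  have hfG : ∀ x y, ∑ z, f x z * G z y = 2 * ∑ z, f x z * g z y - 1 := fun x y => by
    rw [Finset.mul_sum, ← hf1 x, ← Finset.sum_sub_distrib]
    exact Finset.sum_congr rfl fun z _ => by simp only [hG]; ring
  have hp0 : ∀ x y, 0 ≤ ∑ z, f x z * g z y := fun x y =>
    Finset.sum_nonneg fun z _ => mul_nonneg (hf x z) (hg0 z y)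
  have hp1 : ∀ x y, ∑ z, f x z * g z y ≤ 1 := fun x y => by
    rw [← hf1 x]
    exact Finset.sum_le_sum fun z _ => mul_le_of_le_one_right (hf x z) (hg1 z y)
  -- Outside the gap the correlation is at least `|u| / 3`; inside it is at least `-|u|`, and there
  -- `|u| / 3 + |u| ≤ √N / 24`.
  have hpt : ∀ x y, |u x y| / 3 - √N / 24 ≤ u x y * ∑ z, f x z * G z y := by
    intro x y
    rw [hfG]
    rcases le_or_gt (√N / 32) (u x y) with h | h
    · have := hhigh x y h
      rw [abs_of_nonneg (by linarith)]
      nlinarith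
    rcases le_or_gt (u x y) (-(√N / 32)) with h' | h'
    · have := hlow x y h'
      rw [abs_of_nonpos (by linarith)]
      nlinarith
    · have h1 : |u x y| ≤ √N / 32 := abs_le.2 ⟨h'.le, h.le⟩
      have h2 : |2 * ∑ z, f x z * g z y - 1| ≤ 1 :=
        abs_le.2 ⟨by linarith [hp0 x y], by linarith [hp1 x y]⟩
      have h3 : |u x y * (2 * ∑ z, f x z * g z y - 1)| ≤ |u x y| := by
        rw [abs_mul]; exact mul_le_of_le_one_right (abs_nonneg _) h2
      linarith [neg_abs_le (u x y * (2 * ∑ z, f x z * g z y - 1))]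
  have hlower : 2 ^ N * (2 ^ N * (√N / 24)) ≤ ∑ x, ∑ y, u x y * ∑ z, f x z * G z y := by
    have : ∀ x, 2 ^ N * (√N / 24) ≤ ∑ y, u x y * ∑ z, f x z * G z y := by
      intro x
      have h1 := Finset.sum_le_sum fun y (_ : y ∈ Finset.univ) => hpt x y
      rw [Finset.sum_sub_distrib, ← Finset.sum_div] at h1
      have h2 := sum_abs_inner_sign_ge hN x
      have h3 : ∑ y : Fin N → Bool, √(N : ℝ) / 24 = 2 ^ N * (√N / 24) := by simp
      simp only [hu] at h1 ⊢
      linarith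
    calc _ = ∑ x : Fin N → Bool, (2 : ℝ) ^ N * (√N / 24) := by simp
      _ ≤ _ := Finset.sum_le_sum fun x _ => this x
  set w : Z → Fin N → ℝ := fun z i => (∑ y, G z y * boolSign (y i)) / 2 ^ N with hw
  have hw1 : ∀ z, ∑ i, w z i ^ 2 ≤ 1 := by
    intro z
    simp only [hw, div_pow]
    rw [← Finset.sum_div, div_le_one (by positivity)]
    exact sum_sq_sign_coeff_le _ (hGabs z)
  have hsum : ∑ x, ∑ y, u x y * ∑ z, f x z * G z y =
      2 ^ N * ∑ x, ∑ z, f x z * ∑ i, w z i * boolSign (x i) := by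
    rw [Finset.mul_sum]
    refine Finset.sum_congr rfl fun x _ => ?_
    simp_rw [Finset.mul_sum]
    rw [Finset.sum_comm]
    refine Finset.sum_congr rfl fun z _ => ?_
    simp only [hu, hw, Finset.sum_mul, Finset.sum_div, Finset.mul_sum]
    rw [Finset.sum_comm]
    refine Finset.sum_congr rfl fun i _ => Finset.sum_congr rfl fun y _ => ?_
    field_simp
  -- A mean correlation of at least `b` gives `log (card Z) ≥ t * b - t ^ 2 / 2` for every `t`, which
  -- is best for `t = b`; here `b = √N / 24`.
  have hupper := correlation_le_log_card f hf hf1 w hw1 (√N / 24)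
  rw [hsum] at hlower
  have h1 := le_of_mul_le_mul_left hlower hM
  have h2 := mul_le_mul_of_nonneg_left h1 (by positivity : 0 ≤ √(N : ℝ) / 24)
  have h3 : (2 : ℝ) ^ N * (√N / 24 * (√N / 24)) ≤
      2 ^ N * (Real.log (Fintype.card Z) + (√N / 24) ^ 2 / 2) := by linarith
  have h4 := le_of_mul_le_mul_left h3 hM
  have h5 : √(N : ℝ) ^ 2 = N := Real.sq_sqrt (by positivity)
  nlinarith

/-! ### Splitting a run of the algorithm -/

namespace StreamingAlgorithm
variable {U : Type*} {s : ℕ}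

lemma memoryFrom_append (A : StreamingAlgorithm U s) (l₁ l₂ : List U) :
    ∀ (i : ℕ) (m : Fin s → Bool), A.memoryFrom i m (l₁ ++ l₂) =
      (A.memoryFrom i m l₁).bind fun m' => A.memoryFrom (i + l₁.length) m' l₂ := by
  induction l₁ with
  | nil => intro i m; simp [memoryFrom]
  | cons x l ih =>
    intro i m
    simp only [List.cons_append, memoryFrom, PMF.bind_bind, ih, List.length_cons]
    simp only [add_assoc, add_comm 1]

lemma answer_append (A : StreamingAlgorithm U s) (l₁ l₂ : List U) :
    A.answer (l₁ ++ l₂) = (A.finalMemory l₁).bind fun m =>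
      (A.memoryFrom l₁.length m l₂).bind A.output := by
  simp [answer, finalMemory, memoryFrom_append, PMF.bind_bind]

end StreamingAlgorithm

lemma PMF.toOuterMeasure_add_le_one {α : Type*} (p : PMF α) {S T : Set α} (h : Disjoint S T) :
    p.toOuterMeasure S + p.toOuterMeasure T ≤ 1 := by
  rw [PMF.toOuterMeasure_apply, PMF.toOuterMeasure_apply, ← ENNReal.tsum_add, ← p.tsum_coe]
  refine ENNReal.tsum_le_tsum fun a => ?_
  rw [← congrFun (Set.indicator_union_of_disjoint h p) a]
  exact Set.indicator_le_self _ _ _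

lemma PMF.toOuterMeasure_le_one {α : Type*} (p : PMF α) (S : Set α) :
    p.toOuterMeasure S ≤ 1 :=
  le_self_add.trans (p.toOuterMeasure_add_le_one (disjoint_bot_right (a := S)))

lemma PMF.toReal_toOuterMeasure_bind {α β : Type*} [Fintype α] (p : PMF α) (q : α → PMF β)
    (S : Set β) : ((p.bind q).toOuterMeasure S).toReal =
      ∑ a, (p a).toReal * ((q a).toOuterMeasure S).toReal := by
  rw [PMF.toOuterMeasure_bind_apply, tsum_fintype, ENNReal.toReal_sum]
  · simp
  · exact fun a _ => ENNReal.mul_ne_top (p.apply_ne_top a)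
      (ne_top_of_le_ne_top ENNReal.one_ne_top ((q a).toOuterMeasure_le_one S))

lemma PMF.sum_toReal_eq_one {α : Type*} [Fintype α] (p : PMF α) : ∑ a, (p a).toReal = 1 := by
  rw [← ENNReal.toReal_sum fun a _ => p.apply_ne_top a,
    ← tsum_fintype (L := .unconditional _), p.tsum_coe, ENNReal.toReal_one]

/-! ### Streams encoding sign vectors -/

section BitStream

variable {U : Type*} {N r : ℕ}

/-- The stream with `t` copies of the element encoding `(i, x i)` for each coordinate `i`. -/
def bitStream (e : (Fin N × Bool) ⊕ Fin r ↪ U) (t : ℕ) (x : Fin N → Bool) : List U :=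
  (List.finRange N).flatMap fun i => List.replicate t (e (Sum.inl (i, x i)))

/-- The stream of the `r` elements that encode no coordinate, each occurring once. -/
def padStream (e : (Fin N × Bool) ⊕ Fin r ↪ U) : List U :=
  (List.finRange r).map fun k => e (Sum.inr k)

lemma length_bitStream (e : (Fin N × Bool) ⊕ Fin r ↪ U) (t : ℕ) (x : Fin N → Bool) :
    (bitStream e t x).length = N * t := by
  simp [bitStream, List.length_flatMap]

lemma length_padStream (e : (Fin N × Bool) ⊕ Fin r ↪ U) : (padStream e).length = r := by
  simp [padStream]

lemma count_inl_bitStream [DecidableEq U] (e : (Fin N × Bool) ⊕ Fin r ↪ U) (t : ℕ)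
    (x : Fin N → Bool) (i : Fin N) (b : Bool) :
    (bitStream e t x).count (e (Sum.inl (i, b))) = if x i = b then t else 0 := by
  rw [bitStream, List.count_flatMap, ← Fin.sum_univ_def]
  simp only [Function.comp, List.count_replicate, beq_iff_eq, e.injective.eq_iff, Sum.inl.injEq,
    Prod.mk.injEq]
  rw [Finset.sum_eq_single i]
  · simp
  · intro j _ hj; simp [hj]
  · simp

lemma count_inr_bitStream [DecidableEq U] (e : (Fin N × Bool) ⊕ Fin r ↪ U) (t : ℕ)
    (x : Fin N → Bool) (k : Fin r) : (bitStream e t x).count (e (Sum.inr k)) = 0 := by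
  rw [List.count_eq_zero]; simp [bitStream]

lemma count_inl_padStream [DecidableEq U] (e : (Fin N × Bool) ⊕ Fin r ↪ U) (p : Fin N × Bool) :
    (padStream e).count (e (Sum.inl p)) = 0 := by
  rw [List.count_eq_zero]; simp [padStream]

lemma count_inr_padStream [DecidableEq U] (e : (Fin N × Bool) ⊕ Fin r ↪ U) (k : Fin r) :
    (padStream e).count (e (Sum.inr k)) = 1 := by
  have h : (padStream e).count (e (Sum.inr k)) = (List.finRange r).count k :=
    List.count_map_of_injective _ _ (e.injective.comp Sum.inr_injective) k
  rw [h, List.count_eq_one_of_mem (List.nodup_finRange r) (List.mem_finRange k)]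

lemma secondMoment_eq_sum_embedding {α : Type*} [Fintype α] [Fintype U] [DecidableEq U]
    (e : α ↪ U) (l : List U) (hl : ∀ u ∈ l, u ∈ Set.range e) :
    secondMoment l = ∑ a, l.count (e a) ^ 2 := by
  unfold secondMoment
  rw [← Finset.sum_subset (Finset.subset_univ (Finset.univ.map e)), Finset.sum_map]
  intro u _ hu
  rw [List.count_eq_zero_of_not_mem, zero_pow two_ne_zero]
  intro h
  obtain ⟨a, rfl⟩ := hl u h
  simp at hu

lemma secondMoment_bitStream_append [Fintype U] [DecidableEq U]
    (e : (Fin N × Bool) ⊕ Fin r ↪ U) (t : ℕ) (x y : Fin N → Bool) :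
    (secondMoment (bitStream e t x ++ (bitStream e t y ++ padStream e)) : ℝ) =
      t ^ 2 * (3 * N + ∑ i, boolSign (x i) * boolSign (y i)) + r := by
  -- A coordinate contributes `(2 * t) ^ 2` if `x` and `y` agree there, and `t ^ 2 + t ^ 2` if not.
  have h : ∀ i : Fin N,
      ((if x i = true then (t : ℝ) else 0) + if y i = true then (t : ℝ) else 0) ^ 2
      + ((if x i = false then (t : ℝ) else 0) + if y i = false then (t : ℝ) else 0) ^ 2 =
      t ^ 2 * (3 + boolSign (x i) * boolSign (y i)) := by
    intro i
    cases x i <;> cases y i <;> simp [boolSign] <;> ring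
  rw [secondMoment_eq_sum_embedding e]
  · simp only [List.count_append, Fintype.sum_sum_type, Fintype.sum_prod_type,
      Fintype.sum_bool, count_inl_bitStream, count_inl_padStream, count_inr_bitStream,
      count_inr_padStream]
    push_cast
    simp only [add_zero, h]
    rw [← Finset.mul_sum, Finset.sum_add_distrib]
    simp [mul_comm]
  · simp only [bitStream, padStream, List.mem_append, List.mem_flatMap, List.mem_map,
      List.mem_replicate]
    rintro u (⟨i, -, -, rfl⟩ | ⟨i, -, -, rfl⟩ | ⟨k, -, rfl⟩) <;> exact Set.mem_range_self _

end BitStream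

/-! ### From streaming algorithms to one-way protocols -/

namespace StreamingAlgorithm

lemma approximates_append {U : Type*} [Fintype U] [DecidableEq U] {s n : ℕ} {ε : ℝ}
    {A : StreamingAlgorithm U s} (h : A.ApproximatesSecondMoment n ε) (l₁ l₂ : List U)
    (hl : (l₁ ++ l₂).length = n) :
    2 / 3 ≤ ∑ z, (A.finalMemory l₁ z).toReal *
      (((A.memoryFrom l₁.length z l₂).bind A.output).toOuterMeasure
        {a : ℝ | (1 - ε) * (secondMoment (l₁ ++ l₂) : ℝ) ≤ a ∧
          a ≤ (1 + ε) * (secondMoment (l₁ ++ l₂) : ℝ)}).toReal := by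
  rw [← PMF.toReal_toOuterMeasure_bind, ← answer_append]
  have := ENNReal.toReal_mono
    (ne_top_of_le_ne_top ENNReal.one_ne_top (PMF.toOuterMeasure_le_one _ _)) (h _ hl)
  simpa using this

/-- The state after the first half of the stream, which encodes `x`, is a message from which the
second half decides the sign of `⟪x, y⟫` by comparing the answer with the second moment `T` that
corresponds to `⟪x, y⟫ = 0`. -/
lemma le_memory_of_approximates {U : Type*} [Fintype U] [DecidableEq U] {s n N r t : ℕ} {ε : ℝ}
    {A : StreamingAlgorithm U s} (h : A.ApproximatesSecondMoment n ε)
    (hN : 0 < N) (hn : 2 * N * t + r = n) (hU : 2 * N + r ≤ Fintype.card U)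
    (ht : 0 < t) (hr : r ≤ 2 * N) (hε : 0 < ε) (hε' : ε ≤ 1 / 2) (hεN : ε * √N ≤ 1 / 400) :
    (N : ℝ) / 1152 ≤ s := by
  obtain ⟨e⟩ : Nonempty ((Fin N × Bool) ⊕ Fin r ↪ U) :=
    Function.Embedding.nonempty_of_card_le (by simpa [mul_comm] using hU)
  -- The value of the second moment for `⟪x, y⟫ = 0`.
  set T : ℝ := t ^ 2 * (3 * N) + r with hT
  have hlen : ∀ x y : Fin N → Bool,
      (bitStream e t x ++ (bitStream e t y ++ padStream e)).length = n := fun x y => by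
    simp only [List.length_append, length_bitStream, length_padStream]
    rw [← hn]; ring
  set μ : (Fin s → Bool) → (Fin N → Bool) → PMF ℝ := fun z y =>
    (A.memoryFrom (N * t) z (bitStream e t y ++ padStream e)).bind A.output with hμ
  have key := fun x y => approximates_append h (bitStream e t x) _ (hlen x y)
  simp only [length_bitStream, secondMoment_bitStream_append] at key
  have hfin : ∀ z y S, (μ z y).toOuterMeasure S ≠ ⊤ := fun z y S =>
    ne_top_of_le_ne_top ENNReal.one_ne_top (PMF.toOuterMeasure_le_one _ _)
  have hNr : √(N : ℝ) * √N = N := Real.mul_self_sqrt (by positivity)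
  have hs : 0 < √(N : ℝ) := by positivity
  have ht1 : (1 : ℝ) ≤ t := by exact_mod_cast ht
  have hr' : (r : ℝ) ≤ 2 * N := by exact_mod_cast hr
  have hTle : T ≤ t ^ 2 * (5 * N) := by
    have : (r : ℝ) ≤ t ^ 2 * (2 * N) := hr'.trans (le_mul_of_one_le_left (by positivity)
      (one_le_pow₀ ht1))
    rw [hT]; linarith
  have hεT : ε * T ≤ t ^ 2 * (√N / 80) := by
    calc ε * T ≤ ε * (t ^ 2 * (5 * (√N * √N))) := by rw [hNr]; gcongr
      _ = t ^ 2 * (5 * √N * (ε * √N)) := by ring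
      _ ≤ t ^ 2 * (5 * √N * (1 / 400)) := by gcongr
      _ = t ^ 2 * (√N / 80) := by ring
  have ht2 : (0 : ℝ) < t ^ 2 := by positivity
  have hts : 0 < (t : ℝ) ^ 2 * √N := by positivity
  have hlog := gap_inner_one_way hN (fun x z => (A.finalMemory (bitStream e t x) z).toReal)
    (fun _ _ => ENNReal.toReal_nonneg) (fun _ => PMF.sum_toReal_eq_one _)
    (fun z y => ((μ z y).toOuterMeasure (Set.Ioi T)).toReal)
    (fun _ _ => ENNReal.toReal_nonneg)
    (fun z y => by
      simpa using ENNReal.toReal_mono ENNReal.one_ne_top ((μ z y).toOuterMeasure_le_one _)) ?_ ?_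
  · refine hlog.trans ?_
    simp only [Fintype.card_pi_const, Fintype.card_bool, Nat.cast_pow, Nat.cast_ofNat, Real.log_pow]
    have : Real.log 2 ≤ 1 := by linarith [Real.log_two_lt_d9]
    exact mul_le_of_le_one_right (by positivity) this
  · intro x y hxy
    refine (key x y).trans (Finset.sum_le_sum fun z _ => ?_)
    gcongr
    · exact hfin _ _ _
    rintro a ⟨ha, -⟩
    refine lt_of_lt_of_le ?_ ha
    set u := ∑ i, boolSign (x i) * boolSign (y i)
    have h1 : (t : ℝ) ^ 2 * (√N / 32) ≤ t ^ 2 * u := by gcongr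
    have h2 : (1 - ε) * (t ^ 2 * (3 * N + u) + r) = T + ((1 - ε) * (t ^ 2 * u) - ε * T) := by
      rw [hT]; ring
    rw [h2]
    nlinarith
  · intro x y hxy
    have hcompl : ∀ z, ((μ z y).toOuterMeasure (Set.Ioi T)).toReal ≤
        1 - ((μ z y).toOuterMeasure (Set.Iic T)).toReal := fun z => by
      have := ENNReal.toReal_mono ENNReal.one_ne_top
        ((μ z y).toOuterMeasure_add_le_one (Set.Ioi_disjoint_Iic le_rfl : Disjoint (Set.Ioi T) _))
      rw [ENNReal.toReal_add (hfin _ _ _) (hfin _ _ _), ENNReal.toReal_one] at this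
      linarith
    have hle : 2 / 3 ≤ ∑ z, (A.finalMemory (bitStream e t x) z).toReal *
        ((μ z y).toOuterMeasure (Set.Iic T)).toReal := by
      refine (key x y).trans (Finset.sum_le_sum fun z _ => ?_)
      gcongr
      · exact hfin _ _ _
      rintro a ⟨-, ha⟩
      refine ha.trans ?_
      set u := ∑ i, boolSign (x i) * boolSign (y i)
      have h1 : (t : ℝ) ^ 2 * u ≤ t ^ 2 * -(√N / 32) := by gcongr
      have h2 : (1 + ε) * (t ^ 2 * (3 * N + u) + r) = T + ((1 + ε) * (t ^ 2 * u) + ε * T) := by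
        rw [hT]; ring
      rw [h2]
      nlinarith
    calc _ ≤ ∑ z, (A.finalMemory (bitStream e t x) z).toReal *
          (1 - ((μ z y).toOuterMeasure (Set.Iic T)).toReal) :=
        Finset.sum_le_sum fun z _ => mul_le_mul_of_nonneg_left (hcompl z) ENNReal.toReal_nonneg
      _ ≤ 1 / 3 := by
        simp only [mul_sub, mul_one, Finset.sum_sub_distrib, PMF.sum_toReal_eq_one]
        linarith

lemma secondMoment_replicate {U : Type*} [Fintype U] [DecidableEq U] (n : ℕ) (u : U) :
    secondMoment (List.replicate n u) = n ^ 2 := by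
  rw [secondMoment, Finset.sum_eq_single u]
  · simp
  · intro v _ hv; simp [List.count_replicate, hv.symm]
  · simp

lemma secondMoment_finRange_map {U : Type*} [Fintype U] [DecidableEq U] {n : ℕ}
    (e : Fin n ↪ U) : secondMoment ((List.finRange n).map e) = n := by
  rw [secondMoment_eq_sum_embedding e _ (by simp)]
  simp [List.count_map_of_injective _ _ e.injective,
    List.count_eq_one_of_mem (List.nodup_finRange n)]

/-- Without memory the answer has the same distribution on a constant stream, with second moment
`n ^ 2`, and on a stream of distinct elements, with second moment `n`. The hypothesis on `ε` says
that the two intervals of accepted answers are disjoint. -/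
lemma pos_of_approximates {U : Type*} [Fintype U] [DecidableEq U] {s n : ℕ} {ε : ℝ}
    {A : StreamingAlgorithm U s} (h : A.ApproximatesSecondMoment n ε)
    (hU : n ≤ Fintype.card U) (hn : 0 < n) (hε : 1 + ε < (1 - ε) * n) : 0 < s := by
  rw [Nat.pos_iff_ne_zero]
  rintro rfl
  obtain ⟨e⟩ : Nonempty (Fin n ↪ U) := Function.Embedding.nonempty_of_card_le (by simpa using hU)
  have h1 := h ((List.finRange n).map e) (by simp)
  have h2 := h (List.replicate n (e ⟨0, hn⟩)) (by simp)
  -- There is only one distribution on the single memory state.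
  have hfin : ∀ p q : PMF (Fin 0 → Bool), p = q := by
    intro p q
    ext z
    have hp := p.tsum_coe
    have hq := q.tsum_coe
    rw [tsum_fintype, Fintype.sum_subsingleton _ z] at hp hq
    rw [hp, hq]
  rw [answer, hfin (A.finalMemory _) (A.finalMemory (List.replicate n (e ⟨0, hn⟩))),
    secondMoment_finRange_map] at h1
  rw [secondMoment_replicate] at h2
  have hn' : (0 : ℝ) < n := by exact_mod_cast hn
  have h3 := (add_le_add h1 h2).trans (PMF.toOuterMeasure_add_le_one _ ?_)
  · have := ENNReal.toReal_mono ENNReal.one_ne_top h3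
    rw [ENNReal.toReal_add (by finiteness) (by finiteness)] at this
    norm_num at this
  · rw [Set.disjoint_left]
    rintro a ⟨-, ha⟩ ⟨hb, -⟩
    push_cast at hb
    nlinarith

end StreamingAlgorithm

/-! ### The lower bound -/

theorem mainTheorem3 (c : ℝ) (hc : 0 < c) :
    ∃ C : ℝ, 0 < C ∧ ∀ δ : ℝ, 0 < δ → ∃ n₀ : ℕ, ∀ n : ℕ, n₀ ≤ n →
      ∀ ε : ℝ, c / Real.sqrt n ≤ ε → ε ≤ 1 - δ →
        ∀ (U : Type*) [Fintype U] [DecidableEq U], n ≤ Fintype.card U →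
          ∀ (s : ℕ) (A : StreamingAlgorithm U s),
            A.ApproximatesSecondMoment n ε → C / ε ^ 2 ≤ (s : ℝ) := by
  -- `N = ⌊a / ε ^ 2⌋`: the bound `a ≤ 1 / 400 ^ 2` makes `ε * √N` small enough for the reduction, and
  -- `a ≤ c ^ 2 / 2` makes streams for `N` coordinates fit into length `n`.
  set a : ℝ := min (1 / 160000) (c ^ 2 / 2) with ha
  have ha0 : 0 < a := by positivity
  have ha1 : a ≤ 1 / 160000 := min_le_left _ _
  have ha2 : a ≤ c ^ 2 / 2 := min_le_right _ _
  refine ⟨a / 2304, by positivity, fun δ hδ => ⟨⌈2 / δ⌉₊ + 1,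
    fun n hn ε hεc hεδ U _ _ hU s A h => ?_⟩⟩
  have hn0 : 0 < n := by omega
  have hn' : (0 : ℝ) < n := by exact_mod_cast hn0
  have hsn : 0 < √(n : ℝ) := by positivity
  have hε : 0 < ε := lt_of_lt_of_le (by positivity) hεc
  have hs : 0 < s := by
    refine StreamingAlgorithm.pos_of_approximates h hU hn0 ?_
    have h1 : 2 / δ ≤ n := (Nat.le_ceil _).trans (by exact_mod_cast (by omega : ⌈2 / δ⌉₊ ≤ n))
    rw [div_le_iff₀ hδ] at h1
    nlinarith
  have hs' : (1 : ℝ) ≤ s := by exact_mod_cast hs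
  have hε2 : 0 < ε ^ 2 := by positivity
  rw [div_le_iff₀ hε2]
  set N := ⌊a / ε ^ 2⌋₊ with hN
  have hlt : a / ε ^ 2 < N + 1 := Nat.lt_floor_add_one _
  rw [div_lt_iff₀ hε2] at hlt
  -- If `N = 0` then `a / ε ^ 2 < 1`, and `s ≥ 1` suffices.
  rcases Nat.eq_zero_or_pos N with h0 | hpos
  · rw [h0] at hlt
    push_cast at hlt
    nlinarith
  have hN1 : (1 : ℝ) ≤ N := by exact_mod_cast hpos
  have hNle : N * ε ^ 2 ≤ a := by
    rw [← le_div_iff₀ hε2]; exact Nat.floor_le (by positivity)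
  have hcn : c ^ 2 ≤ ε ^ 2 * n := by
    rw [div_le_iff₀ hsn] at hεc
    calc c ^ 2 ≤ (ε * √n) ^ 2 := by gcongr
      _ = ε ^ 2 * n := by rw [mul_pow, Real.sq_sqrt hn'.le]
  have h2N : 2 * N ≤ n := by
    have : (2 * N : ℝ) * ε ^ 2 ≤ n * ε ^ 2 := by nlinarith
    exact_mod_cast le_of_mul_le_mul_right this hε2
  have hεN : ε * √N ≤ 1 / 400 := by
    refine abs_le_of_sq_le_sq' ?_ (by norm_num) |>.2
    rw [mul_pow, Real.sq_sqrt (by positivity)]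
    nlinarith
  have hεhalf : ε ≤ 1 / 2 := by nlinarith
  have hr : n % (2 * N) ≤ 2 * N := (Nat.mod_lt _ (by omega)).le
  have ht : 0 < n / (2 * N) := Nat.div_pos h2N (by omega)
  have hdiv := Nat.div_add_mod n (2 * N)
  have hle : 2 * N ≤ 2 * N * (n / (2 * N)) := Nat.le_mul_of_pos_right _ ht
  have hmain :=
    StreamingAlgorithm.le_memory_of_approximates h hpos hdiv (by omega) ht hr hε hεhalf hεN
  nlinarith
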